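/- **Theorem 1.2.** There is a Köthe sequence space that supports a frequently hypercyclic weighted shift but no chaotic weighted shift. More precisely, let $\mathbb K=\mathbb R$ or $\mathbb C$. There are integers $0=N_0<N_1<N_2<\cdots$ with $N_{k+1}-N_k\to\infty$ and a nondecreasing sequence $(\alpha_n)_{n\ge 0}$ of positive real numbers tending to $+\infty$ with $\alpha_0=1$, $$\alpha_{N_k}=\alpha_0+\cdots+\alpha_{N_k-1}\quad(k\ge 1),\qquad \alpha_{n+1}=\alpha_n\quad\text{whenever } n+1\notin\{N_k: k\ge 1\},$$ such that the power series space of order $0$ and infinite type $$\mathcal C_{0,\infty}(\alpha)=\Bigl\{x=(x_n)_{n\ge 0}\in\mathbb K^{\mathbb N_0}:\ \forall p\ge 1,\ p^{\alpha_n}|x_n|\xrightarrow[n\to\infty]{}0\Bigr\},\qquad \|x\|_p=\sup_{n}|x_n|\,p^{\alpha_n}\quad(p=1,2,3,\dots),$$ which is the Köthe sequence space of order $0$ of the matrix $(p^{\alpha_n})_{p\ge 1,n\ge 0}$, has the following two properties. 1. There is a sequence $w=(w_n)_{n\ge0}$ of positive real numbers such that the weighted shift $B_w(x_n)_{n\ge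 0}=(w_{n+1}x_{n+1})_{n\ge 0}$ is a continuous linear operator on $\mathcal C_{0,\infty}(\alpha)$ that is frequently hypercyclic. 2. For no sequence $w$ of positive real numbers is $B_w$ a chaotic continuous linear operator on $\mathcal C_{0,\infty}(\alpha)$. Here an operator $T$ on $X$ is frequently hypercyclic if there is $x\in X$ such that $\{n\ge 0: T^nx\in U\}$ has positive lower density, i.e. $\liminf_{N\to\infty}\frac1{N+1}\operatorname{card}\{n\le N: T^nx\in U\}>0$, for every nonempty open $U\subset X$; and $T$ is chaotic if it has a dense orbit and a dense set of periodic points. -/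

import Mathlib

open Filter Topology

noncomputable section

/-- A Köthe matrix `(a_{m,n})_{m ≥ 1, n ≥ 0}`: strictly positive numbers, nondecreasing in `m`. -/
structure KotheMatrix where
  a : ℕ+ → ℕ → ℝ
  pos : ∀ m n, 0 < a m n
  mono : ∀ m n, a m n ≤ a (m + 1) n

/-- The vector space `c_0(A)`: scalar sequences `x` with `|x_n| a_{m,n} → 0` for every `m ≥ 1`. -/
def KotheMatrix.c0Submodule (𝕜 : Type*) [RCLike 𝕜] (A : KotheMatrix) : Submodule 𝕜 (ℕ → 𝕜) where
  carrier := {x | ∀ m : ℕ+, Tendsto (fun n => ‖x n‖ * A.a m n) atTop (𝓝 0)}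
  zero_mem' := by intro m; simp
  add_mem' := by
    intro x y hx hy m
    have h := (hx m).add (hy m)
    rw [add_zero] at h
    refine squeeze_zero (fun n => mul_nonneg (norm_nonneg _) (A.pos m n).le) (fun n => ?_) h
    rw [← add_mul]
    exact mul_le_mul_of_nonneg_right (norm_add_le _ _) (A.pos m n).le
  smul_mem' := by
    intro c x hx m
    have h := (hx m).const_mul ‖c‖
    rw [mul_zero] at h
    refine h.congr (fun n => ?_)
    simp [mul_assoc]

/-- The Köthe sequence space of order `0`. It is a type of its own, so that it does not inherit
the topology of coordinatewise convergence from `ℕ → 𝕜`. -/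
def KotheC0 (𝕜 : Type*) [RCLike 𝕜] (A : KotheMatrix) : Type _ := A.c0Submodule 𝕜

namespace KotheC0

variable {𝕜 : Type*} [RCLike 𝕜] {A : KotheMatrix}

instance : AddCommGroup (KotheC0 𝕜 A) := inferInstanceAs (AddCommGroup (A.c0Submodule 𝕜))

instance : Module 𝕜 (KotheC0 𝕜 A) := inferInstanceAs (Module 𝕜 (A.c0Submodule 𝕜))

/-- The `n`-th coordinate of a sequence. -/
def coord (x : KotheC0 𝕜 A) (n : ℕ) : 𝕜 := x.1 n

theorem bddAbove (x : KotheC0 𝕜 A) (m : ℕ+) :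
    BddAbove (Set.range fun n => ‖x.coord n‖ * A.a m n) :=
  (x.2 m).bddAbove_range

/-- The seminorm `‖x‖_m = sup_n |x_n| a_{m,n}`. -/
def seminorm (𝕜 : Type*) [RCLike 𝕜] (A : KotheMatrix) (m : ℕ+) : Seminorm 𝕜 (KotheC0 𝕜 A) :=
  Seminorm.of (fun x => ⨆ n, ‖x.coord n‖ * A.a m n)
    (by
      intro x y
      refine ciSup_le fun n => ?_
      refine le_trans ?_ (add_le_add (le_ciSup (bddAbove x m) n) (le_ciSup (bddAbove y m) n))
      rw [← add_mul]
      exact mul_le_mul_of_nonneg_right (norm_add_le (x.1 n) (y.1 n)) (A.pos m n).le)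
    (by
      intro c x
      rw [Real.mul_iSup_of_nonneg (norm_nonneg c)]
      congr 1
      funext n
      rw [← mul_assoc, ← norm_mul]
      rfl)

/-- The Fréchet space topology, defined by the seminorms `‖·‖_m`, `m ≥ 1`. -/
instance : TopologicalSpace (KotheC0 𝕜 A) :=
  (SeminormFamily.moduleFilterBasis (seminorm 𝕜 A)).topology

theorem withSeminorms : WithSeminorms (seminorm 𝕜 A) := ⟨rfl⟩

end KotheC0

/-- The matrix `a_{p,n} = p ^ α_n`, where the exponents `α_n` are positive. -/
def powerSeriesMatrix (α : ℕ → ℝ) (hα : ∀ n, 0 < α n) : KotheMatrix where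
  a p n := ((p : ℕ) : ℝ) ^ α n
  pos p n := Real.rpow_pos_of_pos (by exact_mod_cast p.pos) _
  mono p n := by
    refine Real.rpow_le_rpow (Nat.cast_nonneg _) ?_ (hα n).le
    exact_mod_cast (Nat.le_succ (p : ℕ))

/-- The power series space `C_{0,∞}(α)` of order `0` and infinite type. -/
abbrev PowerSeriesC0 (𝕜 : Type*) [RCLike 𝕜] (α : ℕ → ℝ) (hα : ∀ n, 0 < α n) : Type _ :=
  KotheC0 𝕜 (powerSeriesMatrix α hα)

/-- The lower density `liminf_N card {n ≤ N : n ∈ A} / (N + 1)` of a set of natural numbers. -/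
def lowerDensity (A : Set ℕ) : ℝ :=
  liminf (fun N : ℕ => (({n | n ≤ N ∧ n ∈ A} : Set ℕ).ncard : ℝ) / ((N : ℝ) + 1)) atTop

/-- `T` has a dense orbit and a dense set of periodic points. -/
def IsChaotic {X : Type*} [TopologicalSpace X] (T : X → X) : Prop :=
  (∃ x : X, Dense (Set.range fun n : ℕ => T^[n] x)) ∧ Dense (Function.periodicPts T)

/-- There is a vector whose orbit visits every nonempty open set along a set of times of positive
lower density. -/
def IsFrequentlyHypercyclic {X : Type*} [TopologicalSpace X] (T : X → X) : Prop :=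
  ∃ x : X, ∀ U : Set X, IsOpen U → U.Nonempty → 0 < lowerDensity {n : ℕ | T^[n] x ∈ U}

/-- The operator (continuous linear map) `T` on `c_0(A)` is the unilateral weighted shift
`B_w (x_n)_{n ≥ 0} = (w_{n+1} x_{n+1})_{n ≥ 0}` for a sequence `w` of positive reals. -/
structure IsWeightedShift {𝕜 : Type*} [RCLike 𝕜] {A : KotheMatrix} (w : ℕ → ℝ)
    (T : KotheC0 𝕜 A →L[𝕜] KotheC0 𝕜 A) : Prop where
  weight_pos : ∀ n, 0 < w n
  apply_coord : ∀ x n, (T x).coord n = (w (n + 1) : 𝕜) * x.coord (n + 1)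

end

/-! No chaos: continuity gives w_n ≤ C Q^{α_n}, so v_n = w_1⋯w_n is at most C^n Q^{α_1+⋯+α_n}. A
point x of period m satisfies x_0 = v_{mj} x_{mj}. Let mj be the first multiple of m from N_k on,
where the gap after N_k is at least m. As α_{N_k} equals the sum of all earlier exponents,
α_1+⋯+α_{mj} ≤ (m+1) α_{mj}. Hence |x_{mj}| p^{α_{mj}} ≥ |x_0| once p ≥ (CQ)^{m+1}, for arbitrarily
large mj, which forces x_0 = 0 (`not_isChaotic_of_isWeightedShift`).

Frequent hypercyclicity: take w_n = 2^{α_n}. If α is constant on (d-c, d], then v_d ≥ 2^{c α_d} and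
p^{α_d}/v_d ≤ p/2^c for p ≤ 2^c (`rpow_div_weightProd_le`), so only coordinates shortly after a jump
are dangerous. For x_k = b_k/v_k one has (T^n x)_d = b_{n+d}/v_d. Thus b should carry each target
f_l at times n of positive lower density, with the distances from n to later entries of b never
falling shortly after a jump.

Powers of 16 achieve this: the jumps are at 4·16^k, and copies of f_l start at 16^u + 3·16^l j for
those u that have label l. Distances to later blocks fall well inside jump-free intervals
(`noJump_of_block`); distances within a block are close to multiples of 3·16^l, which the jumps
avoid modulo 3·16^l (`noJump_of_multiple`). Each label recurs with bounded gaps in u, which gives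
the density (`lowerDensity_pos_of_visitTimes_subset`). -/

open Filter Topology

noncomputable section

/-! ### Coordinates, seminorms and open sets in c_0(A) -/

namespace KotheC0

variable {𝕜 : Type*} [RCLike 𝕜] {A : KotheMatrix}

/-- The element of `c_0(A)` with given coordinates. -/
def ofSeq (f : ℕ → 𝕜) (hf : ∀ m : ℕ+, Tendsto (fun n => ‖f n‖ * A.a m n) atTop (𝓝 0)) :
    KotheC0 𝕜 A := ⟨f, hf⟩

@[simp]
theorem coord_ofSeq (f : ℕ → 𝕜)
    (hf : ∀ m : ℕ+, Tendsto (fun n => ‖f n‖ * A.a m n) atTop (𝓝 0)) (n : ℕ) :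
    (ofSeq f hf : KotheC0 𝕜 A).coord n = f n := rfl

theorem tendsto_coord (x : KotheC0 𝕜 A) (m : ℕ+) :
    Tendsto (fun n => ‖x.coord n‖ * A.a m n) atTop (𝓝 0) := x.2 m

theorem coord_injective {x y : KotheC0 𝕜 A} (h : ∀ n, x.coord n = y.coord n) : x = y :=
  Subtype.ext (funext h)

@[simp]
theorem coord_add (x y : KotheC0 𝕜 A) (n : ℕ) : (x + y).coord n = x.coord n + y.coord n := rfl

@[simp]
theorem coord_sub (x y : KotheC0 𝕜 A) (n : ℕ) : (x - y).coord n = x.coord n - y.coord n := rfl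

@[simp]
theorem coord_smul (c : 𝕜) (x : KotheC0 𝕜 A) (n : ℕ) : (c • x).coord n = c * x.coord n := rfl

theorem norm_coord_mul_le_seminorm (x : KotheC0 𝕜 A) (m : ℕ+) (n : ℕ) :
    ‖x.coord n‖ * A.a m n ≤ seminorm 𝕜 A m x :=
  le_ciSup (bddAbove x m) n

theorem seminorm_le {x : KotheC0 𝕜 A} {m : ℕ+} {C : ℝ}
    (h : ∀ n, ‖x.coord n‖ * A.a m n ≤ C) : seminorm 𝕜 A m x ≤ C :=
  ciSup_le h

theorem seminorm_mono : Monotone (seminorm 𝕜 A) := by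
  intro m m' h x
  refine seminorm_le fun n => ?_
  have hA : A.a m n ≤ A.a m' n := by
    have hs : Monotone fun k : ℕ => A.a k.succPNat n :=
      monotone_nat_of_le_succ fun k => A.mono k.succPNat n
    simpa only [PNat.succPNat_natPred] using hs (PNat.natPred_le_natPred.2 h)
  exact (mul_le_mul_of_nonneg_left hA (norm_nonneg _)).trans (norm_coord_mul_le_seminorm x m' n)

/-- The `n`-th unit vector. -/
def unit (𝕜 : Type*) [RCLike 𝕜] (A : KotheMatrix) (n : ℕ) : KotheC0 𝕜 A :=
  ofSeq (Pi.single n 1) fun m => by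
    refine tendsto_const_nhds.congr' ?_
    filter_upwards [eventually_gt_atTop n] with k hk
    simp [hk.ne']

theorem coord_unit (n k : ℕ) : (unit 𝕜 A n).coord k = if k = n then 1 else 0 := by
  simp [unit, Pi.single_apply]

theorem seminorm_unit_le (m : ℕ+) (n : ℕ) : seminorm 𝕜 A m (unit 𝕜 A n) ≤ A.a m n := by
  refine seminorm_le fun k => ?_
  rw [coord_unit]
  split_ifs with h
  · simp [h]
  · simpa using (A.pos m n).le

theorem exists_seminorm_ball_subset {U : Set (KotheC0 𝕜 A)} (hU : IsOpen U)
    {x : KotheC0 𝕜 A} (hx : x ∈ U) :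
    ∃ m : ℕ+, ∃ r > 0, ∀ z, seminorm 𝕜 A m (z - x) < r → z ∈ U := by
  obtain ⟨s, r, hr, hs⟩ := (withSeminorms.isOpen_iff_mem_balls U).1 hU x hx
  refine ⟨s.sup id, r, hr, fun z hz => hs ?_⟩
  rw [Seminorm.mem_ball]
  exact (Seminorm.finset_sup_apply_lt hr fun i hi =>
    (seminorm_mono (Finset.le_sup (f := id) hi) (z - x)).trans_lt hz)

theorem isOpen_coord_ne_zero (n : ℕ) : IsOpen {x : KotheC0 𝕜 A | x.coord n ≠ 0} := by
  rw [withSeminorms.isOpen_iff_mem_balls]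
  intro x hx
  refine ⟨{1}, ‖x.coord n‖ * A.a 1 n, mul_pos (norm_pos_iff.2 hx) (A.pos 1 n), fun z hz hz0 => ?_⟩
  rw [Finset.sup_singleton, Seminorm.mem_ball] at hz
  have h := (norm_coord_mul_le_seminorm (z - x) 1 n).trans_lt hz
  simp [hz0] at h

end KotheC0

/-! ### Weight products and the growth of the weights -/

/-- The products `w_1 ⋯ w_n` of the weights of a weighted shift. -/
def weightProd (w : ℕ → ℝ) (n : ℕ) : ℝ := ∏ i ∈ Finset.range n, w (i + 1)

theorem weightProd_pos {w : ℕ → ℝ} (hw : ∀ n, 0 < w n) (n : ℕ) : 0 < weightProd w n :=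
  Finset.prod_pos fun i _ => hw (i + 1)

namespace IsWeightedShift

variable {𝕜 : Type*} [RCLike 𝕜]

/-- In the coordinates v_k x_k, with v_k the weight product, the weighted shift becomes the
unweighted one. -/
theorem coord_iterate {A : KotheMatrix} {w : ℕ → ℝ} {T : KotheC0 𝕜 A →L[𝕜] KotheC0 𝕜 A}
    (hT : IsWeightedShift w T) (x : KotheC0 𝕜 A) (n k : ℕ) :
    (weightProd w k : 𝕜) * (T^[n] x).coord k = (weightProd w (k + n) : 𝕜) * x.coord (k + n) := by
  induction n generalizing k with
  | zero => simp
  | succ n ih =>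
    have h := ih (k + 1)
    rw [Function.iterate_succ_apply', hT.apply_coord, ← mul_assoc, ← RCLike.ofReal_mul]
    rw [show weightProd w k * w (k + 1) = weightProd w (k + 1) from
      (Finset.prod_range_succ _ _).symm, h, show k + (n + 1) = k + 1 + n by ring]

/-- Test continuity on the unit vectors, with the seminorm of index 1 on the left, where 1^{α_n} =
1. -/
theorem exists_weight_le {α : ℕ → ℝ} {hα : ∀ n, 0 < α n} {w : ℕ → ℝ}
    {T : PowerSeriesC0 𝕜 α hα →L[𝕜] PowerSeriesC0 𝕜 α hα} (hT : IsWeightedShift w T) :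
    ∃ C Q : ℝ, 1 ≤ C ∧ 1 ≤ Q ∧ ∀ n, w (n + 1) ≤ C * Q ^ α (n + 1) := by
  have hcont : Continuous ((KotheC0.seminorm 𝕜 (powerSeriesMatrix α hα) 1).comp
      (T : PowerSeriesC0 𝕜 α hα →ₗ[𝕜] PowerSeriesC0 𝕜 α hα)) :=
    (KotheC0.withSeminorms.continuous_seminorm 1).comp T.continuous
  obtain ⟨s, C, -, hC⟩ := Seminorm.bound_of_continuous KotheC0.withSeminorms _ hcont
  refine ⟨max C 1, ((s.sup id : ℕ+) : ℕ), le_max_right _ _, by exact_mod_cast (s.sup id).pos,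
    fun n => ?_⟩
  have h1 := KotheC0.norm_coord_mul_le_seminorm (T (KotheC0.unit 𝕜 _ (n + 1))) 1 n
  rw [hT.apply_coord, KotheC0.coord_unit] at h1
  have h2 := hC (KotheC0.unit 𝕜 _ (n + 1))
  have h3 : (s.sup (KotheC0.seminorm 𝕜 (powerSeriesMatrix α hα))) (KotheC0.unit 𝕜 _ (n + 1)) ≤
      (powerSeriesMatrix α hα).a (s.sup id) (n + 1) := by
    refine le_trans ?_ (KotheC0.seminorm_unit_le (𝕜 := 𝕜) _ _)
    exact Seminorm.finset_sup_apply_le (apply_nonneg _ _) fun i hi =>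
      KotheC0.seminorm_mono (Finset.le_sup (f := id) hi) _
  have h4 : (C : ℝ) * (s.sup (KotheC0.seminorm 𝕜 (powerSeriesMatrix α hα)))
      (KotheC0.unit 𝕜 _ (n + 1)) ≤
      max (C : ℝ) 1 * (powerSeriesMatrix α hα).a (s.sup id) (n + 1) :=
    mul_le_mul (le_max_left _ _) h3 (apply_nonneg _ _) (zero_le_one.trans (le_max_right _ _))
  have h5 : ‖(w (n + 1) : 𝕜) * (if n + 1 = n + 1 then 1 else 0)‖ *
      (powerSeriesMatrix α hα).a 1 n = w (n + 1) := by
    simp [powerSeriesMatrix, abs_of_pos (hT.weight_pos (n + 1))]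
  rw [h5] at h1
  exact h1.trans (h2.trans h4)

end IsWeightedShift

/-! ### Absence of chaotic shifts -/

/-- A sequence of exponents that is locally constant away from `N` is constant on intervals that
contain no further point of `N`. -/
theorem eq_of_forall_notMem {N : ℕ → ℕ} {α : ℕ → ℝ}
    (hconst : ∀ n, n + 1 ∉ Set.range N → α (n + 1) = α n) {j k : ℕ} (hjk : j ≤ k)
    (h : ∀ t, j < N t → k < N t) : α j = α k := by
  induction k, hjk using Nat.le_induction with
  | base => rfl
  | succ k hk ih =>
    rw [ih fun t ht => (h t ht).trans_le' (Nat.le_succ k), hconst]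
    rintro ⟨t, ht⟩
    have := h t (by omega)
    omega

theorem not_isChaotic_of_isWeightedShift {𝕜 : Type*} [RCLike 𝕜] {N : ℕ → ℕ} {α : ℕ → ℝ}
    {hα : ∀ n, 0 < α n} (hN : StrictMono N)
    (hgap : Tendsto (fun k => N (k + 1) - N k) atTop atTop) (hα1 : ∀ n, 1 ≤ α n)
    (hsum : ∀ k, 1 ≤ k → α (N k) = ∑ i ∈ Finset.range (N k), α i)
    (hconst : ∀ n, n + 1 ∉ Set.range N → α (n + 1) = α n) {w : ℕ → ℝ}
    {T : PowerSeriesC0 𝕜 α hα →L[𝕜] PowerSeriesC0 𝕜 α hα} (hT : IsWeightedShift w T) :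
    ¬ IsChaotic T := by
  rintro ⟨-, hper⟩
  obtain ⟨x, hx0, hx⟩ := hper.inter_open_nonempty _
    (KotheC0.isOpen_coord_ne_zero (𝕜 := 𝕜) (A := powerSeriesMatrix α hα) 0)
    ⟨KotheC0.unit 𝕜 _ 0, by simp [KotheC0.coord_unit]⟩
  obtain ⟨m, hm, hxm⟩ := hx
  obtain ⟨C, Q, hC, hQ, hw⟩ := hT.exists_weight_le
  have hprod : ∀ n, weightProd w n ≤ C ^ n * Q ^ ∑ i ∈ Finset.range n, α (i + 1) := by
    intro n
    rw [Real.rpow_sum_of_pos (zero_lt_one.trans_le hQ)]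
    calc weightProd w n ≤ ∏ i ∈ Finset.range n, C * Q ^ α (i + 1) :=
          Finset.prod_le_prod (fun i _ => (hT.weight_pos _).le) fun i _ => hw i
      _ = _ := by rw [Finset.prod_mul_distrib]; simp
  -- Both mj and α_1+⋯+α_{mj} will be at most (m+1) α_{N_k}, which dictates this p.
  obtain ⟨p, hp⟩ := exists_nat_ge ((C * Q) ^ (m + 1))
  have hCQ : 1 ≤ (C * Q) ^ (m + 1) := one_le_pow₀ (one_le_mul_of_one_le_of_one_le hC hQ)
  have hp0 : 0 < p := by exact_mod_cast zero_lt_one.trans_le (hCQ.trans hp)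
  have hlim := x.tendsto_coord ⟨p, hp0⟩
  obtain ⟨n₀, hn₀⟩ := eventually_atTop.1 (hlim.eventually_lt_const (norm_pos_iff.2 hx0))
  obtain ⟨k, hk, hk1, hkn⟩ := ((hgap.eventually_ge_atTop m).and
    ((eventually_ge_atTop 1).and (hN.tendsto_atTop.eventually_ge_atTop n₀))).exists
  -- j is N_k/m rounded up.
  obtain ⟨j, hj1, hj2⟩ : ∃ j, N k ≤ m * j ∧ m * j < N k + m := by
    refine ⟨(N k + (m - 1)) / m, ?_, ?_⟩
    · have := Nat.lt_mul_div_succ (N k + (m - 1)) hm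
      rw [mul_add] at this
      omega
    · have := Nat.mul_div_le (N k + (m - 1)) m
      omega
  have hα_eq : ∀ i, N k ≤ i → i < N k + m → α i = α (N k) := by
    intro i hi hi'
    refine (eq_of_forall_notMem hconst hi fun t ht => ?_).symm
    have : N (k + 1) ≤ N t := hN.monotone (hN.lt_iff_lt.1 ht)
    omega
  have hiter : T^[m * j] x = x := (Function.IsPeriodicPt.mul_const hxm j)
  have hcoord := hT.coord_iterate x (m * j) 0
  rw [hiter] at hcoord
  have hcoord' : ‖x.coord 0‖ = weightProd w (m * j) * ‖x.coord (m * j)‖ := by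
    have := congrArg norm hcoord
    rwa [norm_mul, norm_mul, zero_add, RCLike.norm_of_nonneg (weightProd_pos hT.weight_pos _).le,
      RCLike.norm_of_nonneg (weightProd_pos hT.weight_pos _).le,
      show weightProd w 0 = 1 from Finset.prod_range_zero _, one_mul] at this
  have hNk : (N k : ℝ) ≤ α (N k) := by
    rw [hsum k hk1]
    calc (N k : ℝ) = ∑ i ∈ Finset.range (N k), (1 : ℝ) := by simp
      _ ≤ _ := Finset.sum_le_sum fun i _ => hα1 i
  have hS : ∑ i ∈ Finset.range (m * j), α (i + 1) ≤ (m + 1) * α (N k) := by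
    calc ∑ i ∈ Finset.range (m * j), α (i + 1)
        ≤ ∑ i ∈ Finset.range (m * j + 1), α i := by
          rw [Finset.sum_range_succ']
          linarith [hα 0]
      _ = ∑ i ∈ Finset.range (N k), α i + ∑ i ∈ Finset.Ico (N k) (m * j + 1), α i :=
          (Finset.sum_range_add_sum_Ico _ (by omega)).symm
      _ = α (N k) + (m * j + 1 - N k : ℕ) * α (N k) := by
          rw [← hsum k hk1, Finset.sum_congr rfl fun i hi => hα_eq i (Finset.mem_Ico.1 hi).1
            (by have := (Finset.mem_Ico.1 hi).2; omega)]
          simp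
      _ ≤ α (N k) + m * α (N k) := by
          have : ((m * j + 1 - N k : ℕ) : ℝ) ≤ m := by exact_mod_cast (by omega)
          have := mul_le_mul_of_nonneg_right this (hα (N k)).le
          linarith
      _ = _ := by ring
  have hn : ((m * j : ℕ) : ℝ) ≤ (m + 1) * α (N k) := by
    have h1 : ((m * j : ℕ) : ℝ) ≤ N k + m := by exact_mod_cast hj2.le
    have h2 : (m : ℝ) * 1 ≤ m * α (N k) := mul_le_mul_of_nonneg_left (hα1 _) (Nat.cast_nonneg m)
    linarith
  have hv : weightProd w (m * j) ≤ (p : ℝ) ^ α (m * j) := by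
    rw [hα_eq _ hj1 hj2]
    calc weightProd w (m * j) ≤ C ^ (m * j) * Q ^ ∑ i ∈ Finset.range (m * j), α (i + 1) := hprod _
      _ ≤ C ^ ((m + 1) * α (N k)) * Q ^ ((m + 1) * α (N k)) := by
          rw [← Real.rpow_natCast]
          gcongr
      _ = ((C * Q) ^ (m + 1)) ^ α (N k) := by
          rw [← Real.mul_rpow (by linarith) (by linarith), Real.rpow_mul (by positivity)]
          congr 1
          exact_mod_cast Real.rpow_natCast (C * Q) (m + 1)
      _ ≤ _ := Real.rpow_le_rpow (zero_le_one.trans hCQ) hp (hα _).le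
  have hlt := hn₀ (m * j) (hkn.trans hj1)
  rw [hcoord', mul_comm] at hlt
  exact absurd hlt (not_lt.2 (mul_le_mul_of_nonneg_right hv (norm_nonneg _)))

/-! ### The shift with weights 2^{α_n} -/

/-- Since 2^α m^α = (2m)^α, the shift costs only the passage from the seminorm m to the seminorm 2m.
-/
theorem norm_expShift_coord_le {𝕜 : Type*} [RCLike 𝕜] {α : ℕ → ℝ} {hα : ∀ n, 0 < α n}
    (hmono : Monotone α) (x : PowerSeriesC0 𝕜 α hα) (m : ℕ+) (n : ℕ) :
    ‖(((2 : ℝ) ^ α (n + 1) : ℝ) : 𝕜) * x.coord (n + 1)‖ * (powerSeriesMatrix α hα).a m n ≤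
      ‖x.coord (n + 1)‖ * (powerSeriesMatrix α hα).a (2 * m) (n + 1) := by
  have h : (2 : ℝ) ^ α (n + 1) * (powerSeriesMatrix α hα).a m n ≤
      (powerSeriesMatrix α hα).a (2 * m) (n + 1) := by
    have hm : (1 : ℝ) ≤ ((m : ℕ) : ℝ) := by exact_mod_cast m.pos
    simp only [powerSeriesMatrix, PNat.mul_coe, Nat.cast_mul]
    rw [Real.mul_rpow (by simp) (by simp)]
    exact mul_le_mul_of_nonneg_left
      (Real.rpow_le_rpow_of_exponent_le hm (hmono (Nat.le_succ n))) (by positivity)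
  rw [norm_mul, RCLike.norm_of_nonneg (by positivity), mul_comm _ ‖x.coord (n + 1)‖, mul_assoc]
  exact mul_le_mul_of_nonneg_left h (norm_nonneg _)

/-- The weighted shift with weights `2 ^ α_n`, as a linear map. -/
def expShiftLinear (𝕜 : Type*) [RCLike 𝕜] {α : ℕ → ℝ} (hα : ∀ n, 0 < α n) (hmono : Monotone α) :
    PowerSeriesC0 𝕜 α hα →ₗ[𝕜] PowerSeriesC0 𝕜 α hα where
  toFun x := KotheC0.ofSeq (fun n => (((2 : ℝ) ^ α (n + 1) : ℝ) : 𝕜) * x.coord (n + 1)) fun m =>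
    squeeze_zero (fun n => mul_nonneg (norm_nonneg _) (KotheMatrix.pos _ _ _).le)
      (fun n => norm_expShift_coord_le hmono x m n)
      ((x.tendsto_coord (2 * m)).comp (tendsto_add_atTop_nat 1))
  map_add' x y := KotheC0.coord_injective fun n => by simp [mul_add]
  map_smul' c x := KotheC0.coord_injective fun n => by simp [mul_left_comm]

/-- The weighted shift with weights `2 ^ α_n`. -/
def expShift (𝕜 : Type*) [RCLike 𝕜] {α : ℕ → ℝ} (hα : ∀ n, 0 < α n) (hmono : Monotone α) :
    PowerSeriesC0 𝕜 α hα →L[𝕜] PowerSeriesC0 𝕜 α hα where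
  toLinearMap := expShiftLinear 𝕜 hα hmono
  cont := by
    refine KotheC0.withSeminorms.continuous_of_isBounded KotheC0.withSeminorms _ ?_
    intro m
    refine ⟨{2 * m}, 1, ?_⟩
    rw [one_smul, Finset.sup_singleton]
    exact fun x => KotheC0.seminorm_le fun n => (norm_expShift_coord_le hmono x m n).trans
      (KotheC0.norm_coord_mul_le_seminorm x (2 * m) (n + 1))

theorem isWeightedShift_expShift (𝕜 : Type*) [RCLike 𝕜] {α : ℕ → ℝ} (hα : ∀ n, 0 < α n)
    (hmono : Monotone α) :
    IsWeightedShift (fun n => (2 : ℝ) ^ α n) (expShift 𝕜 hα hmono) where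
  weight_pos n := by positivity
  apply_coord x n := rfl

/-- If the exponents are constant on `(k - c, k]`, then the weight `p ^ α_k` is small compared with
the product of the weights `2 ^ α_1, …, 2 ^ α_k`. -/
theorem rpow_div_weightProd_le {α : ℕ → ℝ} (hα1 : ∀ n, 1 ≤ α n) {c k p : ℕ} (hck : c ≤ k)
    (h : ∀ j, k < j + c → j ≤ k → α j = α k) (hp : p ≤ 2 ^ c) :
    (p : ℝ) ^ α k / weightProd (fun n => (2 : ℝ) ^ α n) k ≤ p / 2 ^ c := by
  have hv : ((2 : ℝ) ^ c) ^ α k ≤ weightProd (fun n => (2 : ℝ) ^ α n) k := by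
    rw [weightProd, ← Real.rpow_sum_of_pos two_pos, ← Real.rpow_natCast_mul (by norm_num)]
    refine Real.rpow_le_rpow_of_exponent_le (by norm_num) ?_
    calc (c : ℝ) * α k = ∑ i ∈ Finset.Ico (k - c) k, α (i + 1) := by
          rw [Finset.sum_congr rfl fun i hi => h (i + 1)
            (by have := (Finset.mem_Ico.1 hi).1; omega) (Finset.mem_Ico.1 hi).2]
          simp [Nat.sub_sub_self hck]
      _ ≤ ∑ i ∈ Finset.range k, α (i + 1) := by
          refine Finset.sum_le_sum_of_subset_of_nonneg (fun i hi => ?_)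
            fun i _ _ => zero_le_one.trans (hα1 _)
          exact Finset.mem_range.2 (Finset.mem_Ico.1 hi).2
  have hp' : (p : ℝ) ≤ 2 ^ c := by exact_mod_cast hp
  calc (p : ℝ) ^ α k / weightProd (fun n => (2 : ℝ) ^ α n) k
      ≤ (p : ℝ) ^ α k / ((2 : ℝ) ^ c) ^ α k := by gcongr
    _ = ((p : ℝ) / 2 ^ c) ^ α k := by rw [Real.div_rpow (by positivity) (by positivity)]
    _ ≤ p / 2 ^ c := by
        rcases Nat.eq_zero_or_pos p with rfl | hp0
        · simp [Real.zero_rpow (zero_lt_one.trans_le (hα1 k)).ne']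
        · exact Real.rpow_le_self_of_le_one (by positivity)
            (div_le_one_of_le₀ hp' (by positivity)) (hα1 k)

/-! ### Jump times and exponents -/

/-- The times at which the exponents jump. -/
def jumpTime : ℕ → ℕ
  | 0 => 0
  | k + 1 => 4 * 16 ^ k

theorem strictMono_jumpTime : StrictMono jumpTime := by
  refine strictMono_nat_of_lt_succ fun k => ?_
  cases k with
  | zero => simp [jumpTime]
  | succ k =>
    have : 0 < 16 ^ k := by positivity
    simp only [jumpTime, pow_succ]
    omega

theorem tendsto_jumpTime_sub : Tendsto (fun k => jumpTime (k + 1) - jumpTime k) atTop atTop := by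
  refine tendsto_atTop_mono (fun k => ?_) tendsto_id
  cases k with
  | zero => simp
  | succ k =>
    have : k < 16 ^ k := Nat.lt_pow_self (by norm_num)
    simp only [jumpTime, pow_succ, id]
    omega

/-- The pairs consisting of the exponent `α_n` and the sum `α_0 + ⋯ + α_n`. -/
def exponentState : ℕ → ℝ × ℝ
  | 0 => (1, 1)
  | n + 1 =>
    open Classical in
    if n + 1 ∈ Set.range jumpTime then ((exponentState n).2, 2 * (exponentState n).2)
    else ((exponentState n).1, (exponentState n).1 + (exponentState n).2)

/-- The exponents: constant except at the jump times, where they become the sum of all preceding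
exponents. -/
def exponent (n : ℕ) : ℝ := (exponentState n).1

theorem sum_exponent (n : ℕ) : ∑ i ∈ Finset.range (n + 1), exponent i = (exponentState n).2 := by
  induction n with
  | zero => simp [exponent, exponentState]
  | succ n ih =>
    rw [Finset.sum_range_succ, ih, exponent, exponentState]
    split_ifs <;> simp only <;> ring

theorem exponent_succ_of_notMem {n : ℕ} (h : n + 1 ∉ Set.range jumpTime) :
    exponent (n + 1) = exponent n := by
  simp only [exponent, exponentState, if_neg h]

theorem exponent_succ_of_mem {n : ℕ} (h : n + 1 ∈ Set.range jumpTime) :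
    exponent (n + 1) = ∑ i ∈ Finset.range (n + 1), exponent i := by
  rw [sum_exponent]
  simp only [exponent, exponentState, if_pos h]

theorem one_le_exponent (n : ℕ) : 1 ≤ exponent n := by
  induction n using Nat.strong_induction_on with
  | _ n ih =>
    cases n with
    | zero => simp [exponent, exponentState]
    | succ n =>
      by_cases h : n + 1 ∈ Set.range jumpTime
      · rw [exponent_succ_of_mem h]
        exact (ih n (Nat.lt_succ_self n)).trans (Finset.single_le_sum (f := exponent)
          (fun i hi => zero_le_one.trans (ih i (Finset.mem_range.1 hi))) (by simp))
      · rw [exponent_succ_of_notMem h]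
        exact ih n (Nat.lt_succ_self n)

theorem monotone_exponent : Monotone exponent := by
  refine monotone_nat_of_le_succ fun n => ?_
  by_cases h : n + 1 ∈ Set.range jumpTime
  · rw [exponent_succ_of_mem h]
    exact Finset.single_le_sum (f := exponent)
      (fun i _ => zero_le_one.trans (one_le_exponent i)) (by simp)
  · rw [exponent_succ_of_notMem h]

theorem exponent_jumpTime {k : ℕ} (hk : 1 ≤ k) :
    exponent (jumpTime k) = ∑ i ∈ Finset.range (jumpTime k), exponent i := by
  have hpos : 0 < jumpTime k := strictMono_jumpTime (Nat.zero_lt_of_lt hk)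
  obtain ⟨n, hn⟩ := Nat.exists_eq_succ_of_ne_zero hpos.ne'
  rw [hn]
  exact exponent_succ_of_mem ⟨k, hn⟩

theorem tendsto_exponent : Tendsto exponent atTop atTop := by
  refine tendsto_atTop_atTop_of_monotone monotone_exponent fun b => ?_
  obtain ⟨n, hn⟩ := exists_nat_ge b
  refine ⟨jumpTime (n + 1), hn.trans ?_⟩
  rw [exponent_jumpTime (by omega)]
  calc (n : ℝ) ≤ jumpTime (n + 1) := by
        exact_mod_cast (Nat.le_succ n).trans strictMono_jumpTime.le_apply
    _ = ∑ i ∈ Finset.range (jumpTime (n + 1)), (1 : ℝ) := by simp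
    _ ≤ _ := Finset.sum_le_sum fun i _ => one_le_exponent i

/-! ### Distances that keep away from the jumps -/

/-- No jump occurs in the interval `(k - c, k]`. -/
def NoJump (c k : ℕ) : Prop := ∀ t, jumpTime t + c ≤ k ∨ k < jumpTime t

/-- Time 0 counts as a jump. -/
theorem NoJump.le {c k : ℕ} (h : NoJump c k) : c ≤ k := by
  simpa [jumpTime] using h 0

theorem NoJump.mono {c c' k : ℕ} (h : NoJump c k) (hc : c' ≤ c) : NoJump c' k := by
  intro t
  have := h t
  omega

theorem NoJump.rpow_div_weightProd_le {α : ℕ → ℝ} (hα1 : ∀ n, 1 ≤ α n)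
    (hconst : ∀ n, n + 1 ∉ Set.range jumpTime → α (n + 1) = α n) {c k p : ℕ} (h : NoJump c k)
    (hp : p ≤ 2 ^ c) :
    (p : ℝ) ^ α k / weightProd (fun n => (2 : ℝ) ^ α n) k ≤ p / 2 ^ c := by
  refine _root_.rpow_div_weightProd_le hα1 h.le (fun j hj hjk => ?_) hp
  refine eq_of_forall_notMem hconst hjk fun t ht => ?_
  have := h t
  omega

theorem sixteen_mul_le_pow (u : ℕ) : 16 * u ≤ 16 ^ u := by
  cases u with
  | zero => simp
  | succ u =>
    have : u < 16 ^ u := Nat.lt_pow_self (by norm_num)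
    rw [pow_succ]
    omega

/-- The next jump is 4·16^u; the previous one is 16^u/4 (or 0 if u = 0), and (7/8 - 1/4)·16^u ≥ 2u.
-/
theorem noJump_of_block {u d : ℕ} (h1 : 7 * 16 ^ u ≤ 8 * d) (h2 : d < 4 * 16 ^ u) :
    NoJump (2 * u) d := by
  have hu := sixteen_mul_le_pow u
  intro t
  rcases t with _ | t
  · simp only [jumpTime]
    omega
  simp only [jumpTime]
  rcases le_or_gt u t with h | h
  · have := Nat.pow_le_pow_right (n := 16) (by norm_num) h
    omega
  · have := Nat.pow_le_pow_right (n := 16) (by norm_num) (Nat.succ_le_of_lt h)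
    rw [pow_succ] at this
    omega

/-- As 4·16^s ≡ 1 mod 3, a jump 4·16^{l+s} lies 16^l above a multiple of 3·16^l and 2·16^l below the
next, while i ≤ l and 2l are much smaller than 16^l. Earlier jumps are at most 16^l/4. -/
theorem noJump_of_multiple {l j i : ℕ} (hj : 1 ≤ j) (hi : i ≤ l) :
    NoJump (2 * l) (3 * 16 ^ l * j + i) := by
  have hl := sixteen_mul_le_pow l
  have hpos : 0 < 16 ^ l := by positivity
  have hjl : 16 ^ l * 1 ≤ 16 ^ l * j := Nat.mul_le_mul_left _ hj
  rw [mul_assoc]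
  intro t
  rcases t with _ | t
  · simp only [jumpTime]
    omega
  simp only [jumpTime]
  rcases le_or_gt l t with h | h
  · obtain ⟨s, rfl⟩ := Nat.exists_eq_add_of_le h
    obtain ⟨q, hq⟩ : ∃ q, 4 * 16 ^ s = 3 * q + 1 := by
      refine ⟨4 * 16 ^ s / 3, ?_⟩
      have : 4 * 16 ^ s % 3 = 1 := by simp [Nat.mul_mod, Nat.pow_mod]
      omega
    have hN : 4 * 16 ^ (l + s) = 3 * (16 ^ l * q) + 16 ^ l := by
      rw [pow_add]
      calc 4 * (16 ^ l * 16 ^ s) = 16 ^ l * (4 * 16 ^ s) := by ring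
        _ = _ := by rw [hq]; ring
    rw [hN]
    rcases le_or_gt j q with hjq | hjq
    · have := Nat.mul_le_mul_left (16 ^ l) hjq
      omega
    · have := Nat.mul_le_mul_left (16 ^ l) (Nat.succ_le_of_lt hjq)
      rw [Nat.mul_succ] at this
      omega
  · have := Nat.pow_le_pow_right (n := 16) (by norm_num) (Nat.succ_le_of_lt h)
    rw [pow_succ] at this
    omega

/-! ### Visit times and their lower density -/

/-- The label of the block of integers that starts at `16 ^ u`. -/
def blockLabel (u : ℕ) : ℕ := padicValNat 2 (u + 1)

theorem blockLabel_le (u : ℕ) : blockLabel u ≤ u := by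
  have h1 : 2 ^ blockLabel u ≤ u + 1 := Nat.le_of_dvd (Nat.succ_pos u) pow_padicValNat_dvd
  have h2 : blockLabel u < 2 ^ blockLabel u := Nat.lt_pow_self (by norm_num)
  omega

/-- Label l means that u + 1 is an odd multiple of 2^l, and these recur with period 2^{l+1}. The odd
factor chosen is at least 3, which yields l < u. -/
theorem exists_blockLabel_eq (l M : ℕ) (hM : 2 * 2 ^ (l + 1) ≤ M) :
    ∃ u, blockLabel u = l ∧ l < u ∧ u < M ∧ M < u + 1 + 2 ^ (l + 2) := by
  have hl : l < 2 ^ l := Nat.lt_pow_self (by norm_num)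
  have h1 := Nat.mul_div_le M (2 ^ (l + 1))
  have h2 := Nat.lt_mul_div_succ M (show 0 < 2 ^ (l + 1) by positivity)
  have h3 : 2 ≤ M / 2 ^ (l + 1) := (Nat.le_div_iff_mul_le (by positivity)).2 hM
  obtain ⟨t, ht⟩ := Nat.exists_eq_add_of_le h3
  rw [ht] at h1 h2
  have e1 : 2 ^ (l + 1) * (2 + t) = 2 * (2 ^ l * t) + 4 * 2 ^ l := by ring
  have e2 : 2 ^ (l + 1) * (2 + t + 1) = 2 * (2 ^ l * t) + 6 * 2 ^ l := by ring
  have e3 : 2 ^ l * (2 * (t + 1) + 1) = 2 * (2 ^ l * t) + 3 * 2 ^ l := by ring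
  have e4 : 2 ^ (l + 2) = 4 * 2 ^ l := by ring
  rw [e1] at h1
  rw [e2] at h2
  refine ⟨2 ^ l * (2 * (t + 1) + 1) - 1, ?_, by omega, by omega, by omega⟩
  rw [blockLabel, Nat.sub_add_cancel (by omega),
    padicValNat.mul (by positivity) (by omega), padicValNat.prime_pow,
    padicValNat.eq_zero_of_not_dvd (by omega), add_zero]

/-- The times at which an orbit is to be close to the `l`-th target. -/
def visitTimes (l : ℕ) : Set ℕ :=
  {n | ∃ u j, blockLabel u = l ∧ 3 * 16 ^ l * j < 16 ^ u ∧ n = 16 ^ u + 3 * 16 ^ l * j}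

theorem lowerDensity_pos_of_eventually {B : Set ℕ} {δ : ℝ} (hδ : 0 < δ)
    (h : ∀ᶠ N : ℕ in atTop, δ * ((N : ℝ) + 1) ≤ ({n | n ≤ N ∧ n ∈ B} : Set ℕ).ncard) :
    0 < lowerDensity B := by
  refine hδ.trans_le (le_liminf_of_le ?_ ?_)
  -- A real `liminf` is a conditional supremum; the bound 1 on the quotients makes it meaningful.
  · refine IsBoundedUnder.isCoboundedUnder_ge ⟨1, ?_⟩
    rw [eventually_map]
    refine Eventually.of_forall fun N => ?_
    dsimp only
    rw [div_le_one (by positivity)]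
    have : ({n | n ≤ N ∧ n ∈ B} : Set ℕ).ncard ≤ (Set.Iic N).ncard :=
      Set.ncard_le_ncard (fun n hn => hn.1) (Set.finite_Iic N)
    have h2 : (Set.Iic N).ncard = N + 1 := by
      rw [← Finset.coe_Iic, Set.ncard_coe_finset, Nat.card_Iic]
    rw [h2] at this
    exact_mod_cast this
  · filter_upwards [h] with N hN
    rwa [le_div_iff₀ (by positivity)]

/-- A single block suffices: some u of label l has 16^{u+1} ≤ N < 16^{u+2+2^{l+2}}, and block u
contains at least 4·16^{u-l-1} visit times, all at most N. The constant δ is the quotient. -/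
theorem lowerDensity_pos_of_visitTimes_subset {l : ℕ} {B : Set ℕ} (hB : visitTimes l ⊆ B) :
    0 < lowerDensity B := by
  refine lowerDensity_pos_of_eventually (δ := 1 / (4 * 16 ^ l * 16 ^ (2 + 2 ^ (l + 2))))
    (by positivity) ?_
  filter_upwards [eventually_ge_atTop (16 ^ (2 * 2 ^ (l + 1)))] with N hN
  have hN0 : N ≠ 0 := (lt_of_lt_of_le (by positivity) hN).ne'
  have hM : 2 * 2 ^ (l + 1) ≤ Nat.log 16 N := Nat.le_log_of_pow_le (by norm_num) hN
  obtain ⟨u, hul, hlu, hu1, hu2⟩ := exists_blockLabel_eq l _ hM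
  obtain ⟨s, rfl⟩ := Nat.exists_eq_add_of_lt hlu
  have hNlow : 16 ^ (l + s + 1 + 1) ≤ N :=
    (Nat.pow_le_pow_right (by norm_num) hu1).trans (Nat.pow_log_le_self 16 hN0)
  have hNup : N < 16 ^ (l + s + 1 + (2 + 2 ^ (l + 2))) :=
    (Nat.lt_pow_succ_log_self (by norm_num) N).trans_le
      (Nat.pow_le_pow_right (by norm_num) (by omega))
  have hcard : 4 * 16 ^ s ≤ ({n | n ≤ N ∧ n ∈ B} : Set ℕ).ncard := by
    have hinj : Function.Injective fun j => 16 ^ (l + s + 1) + 3 * 16 ^ l * j := by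
      intro a b hab
      exact Nat.eq_of_mul_eq_mul_left (show 0 < 3 * 16 ^ l by positivity) (Nat.add_left_cancel hab)
    rw [← Finset.card_range (4 * 16 ^ s), ← Finset.card_image_of_injective _ hinj,
      ← Set.ncard_coe_finset]
    refine Set.ncard_le_ncard ?_ ((Set.finite_Iic N).subset fun n hn => hn.1)
    intro n hn
    obtain ⟨j, hj, rfl⟩ := Finset.mem_image.1 (Finset.mem_coe.1 hn)
    have hlt : 3 * 16 ^ l * j < 16 ^ (l + s + 1) := by
      have h1 := Nat.mul_lt_mul_of_pos_left (Finset.mem_range.1 hj)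
        (show 0 < 3 * 16 ^ l by positivity)
      have h2 : 3 * 16 ^ l * (4 * 16 ^ s) ≤ 16 ^ (l + s + 1) := by
        rw [pow_succ, pow_add]
        nlinarith [Nat.zero_le (16 ^ l * 16 ^ s)]
      omega
    refine ⟨?_, hB ⟨l + s + 1, j, hul, hlt, rfl⟩⟩
    rw [pow_succ] at hNlow
    omega
  have hcard' : (4 * 16 ^ s : ℝ) ≤ ({n | n ≤ N ∧ n ∈ B} : Set ℕ).ncard := by exact_mod_cast hcard
  refine le_trans ?_ hcard'
  rw [one_div_mul_eq_div, div_le_iff₀ (by positivity)]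
  have : (N : ℝ) + 1 ≤ 16 ^ (l + s + 1 + (2 + 2 ^ (l + 2))) := by exact_mod_cast hNup
  refine this.trans_eq ?_
  rw [pow_add, pow_add, pow_add]
  ring

/-! ### The block sequence -/

/-- A sequence that carries translated copies of the `l`-th target `f l` at all visit times. -/
def blockSeq {𝕜 : Type*} [Zero 𝕜] (f : ℕ → ℕ → 𝕜) (k : ℕ) : 𝕜 :=
  if k < 3 * 16 ^ Nat.log 16 k then
    f (blockLabel (Nat.log 16 k)) ((k - 16 ^ Nat.log 16 k) % (3 * 16 ^ blockLabel (Nat.log 16 k)))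
  else 0

section BlockSeq

variable {𝕜 : Type*} [Zero 𝕜] {f : ℕ → ℕ → 𝕜}

theorem log_eq_of_block {u r : ℕ} (hr : r < 2 * 16 ^ u) : Nat.log 16 (16 ^ u + r) = u := by
  rw [Nat.log_eq_iff (Or.inr ⟨by norm_num, by positivity⟩), pow_succ]
  omega

theorem blockSeq_add {u r : ℕ} (hr : r < 2 * 16 ^ u) :
    blockSeq f (16 ^ u + r) = f (blockLabel u) (r % (3 * 16 ^ blockLabel u)) := by
  rw [blockSeq, log_eq_of_block hr, if_pos (by omega), Nat.add_sub_cancel_left]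

/-- Visits start before 2·16^u but copies are written up to 3·16^u, so the last visited copy is
complete too. -/
theorem blockSeq_visit {u j d : ℕ} (hj : 3 * 16 ^ blockLabel u * j < 16 ^ u)
    (hd : d ≤ blockLabel u) :
    blockSeq f (16 ^ u + 3 * 16 ^ blockLabel u * j + d) = f (blockLabel u) d := by
  have h1 := blockLabel_le u
  have h2 := sixteen_mul_le_pow u
  have h3 := sixteen_mul_le_pow (blockLabel u)
  have h4 : 0 < 16 ^ blockLabel u := by positivity
  rw [add_assoc, blockSeq_add (by omega), Nat.mul_add_mod, Nat.mod_eq_of_lt (by omega)]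

/-- Index 0 is excluded: `Nat.log 16 0 = 0` and truncated subtraction put the stray value `f 0 0`
there. -/
theorem exists_of_blockSeq_ne_zero (hf : ∀ l i, l < i → f l i = 0) {k : ℕ} (hk0 : k ≠ 0)
    (hk : blockSeq f k ≠ 0) :
    ∃ u j i, i ≤ blockLabel u ∧ 3 * 16 ^ blockLabel u * j + i < 2 * 16 ^ u ∧
      k = 16 ^ u + (3 * 16 ^ blockLabel u * j + i) ∧ blockSeq f k = f (blockLabel u) i := by
  rw [blockSeq] at hk
  split_ifs at hk with h
  · set u := Nat.log 16 k
    have h1 : 16 ^ u ≤ k := Nat.pow_log_le_self 16 hk0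
    refine ⟨u, (k - 16 ^ u) / (3 * 16 ^ blockLabel u), (k - 16 ^ u) % (3 * 16 ^ blockLabel u),
      ?_, ?_, ?_, ?_⟩
    · by_contra! hlt
      exact hk (hf _ _ hlt)
    · rw [Nat.div_add_mod]
      omega
    · rw [Nat.div_add_mod]
      omega
    · rw [blockSeq, if_pos h]
  · exact absurd rfl hk

/-- Relative to a visit time, the entries of `blockSeq f` beyond the target are small and keep away
from the jumps. -/
theorem exists_noJump_of_blockSeq_ne_zero (hf : ∀ l i, l < i → f l i = 0) {l n d : ℕ}
    (hn : n ∈ visitTimes l) (hd : l < d) (hk : blockSeq f (n + d) ≠ 0) :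
    ∃ l' i, blockSeq f (n + d) = f l' i ∧ NoJump (l + l') d := by
  obtain ⟨u, j, rfl, hj, rfl⟩ := hn
  obtain ⟨u', j', i, hi, hr, hkeq, hval⟩ := exists_of_blockSeq_ne_zero hf (by omega) hk
  refine ⟨_, _, hval, ?_⟩
  have hb := blockLabel_le u
  have hb' := blockLabel_le u'
  -- For a later block, n < 2·16^u ≤ 16^{u'}/8, so d is at least 7/8 of 16^{u'}. In the same block,
  -- the entry belongs to a later copy because d > l. An earlier block ends before n.
  rcases lt_trichotomy u u' with h | rfl | h
  · have := Nat.pow_le_pow_right (n := 16) (by norm_num) (Nat.succ_le_of_lt h)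
    rw [pow_succ] at this
    exact (noJump_of_block (u := u') (by omega) (by omega)).mono (by omega)
  · rcases lt_or_ge j j' with hjj | hjj
    · obtain ⟨s, rfl⟩ := Nat.exists_eq_add_of_lt hjj
      have : d = 3 * 16 ^ blockLabel u * (s + 1) + i := by
        have e : 3 * 16 ^ blockLabel u * (j + s + 1) =
          3 * 16 ^ blockLabel u * j + 3 * 16 ^ blockLabel u * (s + 1) := by ring
        omega
      rw [this, ← two_mul]
      exact noJump_of_multiple (by omega) hi
    · have := Nat.mul_le_mul_left (3 * 16 ^ blockLabel u) hjj
      omega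
  · have := Nat.pow_le_pow_right (n := 16) (by norm_num) (Nat.succ_le_of_lt h)
    rw [pow_succ] at this
    omega

end BlockSeq

/-! ### Dense targets and the frequently hypercyclic vector -/

/-- There is a sequence of finite sequences of controlled size that comes arbitrarily late
arbitrarily close to every finite sequence. -/
theorem exists_dense_targets (𝕜 : Type*) [RCLike 𝕜] :
    ∃ f : ℕ → ℕ → 𝕜, (∀ l i, l < i → f l i = 0) ∧ (∀ l i, ‖f l i‖ ≤ 2 ^ l) ∧
      ∀ (y : ℕ → 𝕜) (ε : ℕ → ℝ) (n L : ℕ), (∀ i, 0 < ε i) →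
        ∃ l ≥ L, (∀ i < n, ‖f l i - y i‖ < ε i) ∧ ∀ i ≥ n, f l i = 0 := by
  classical
  obtain ⟨e, he⟩ := exists_surjective_nat (ℕ →₀ ℕ)
  -- Code 0 stands for the scalar 0, so finitely supported codes give exact zeros. The second
  -- component of `l.unpair` is free: each code recurs for arbitrarily large l, where the
  -- truncations to length and size no longer act.
  let D : ℕ → 𝕜 := fun k => Nat.casesOn k 0 (TopologicalSpace.denseSeq 𝕜)
  refine ⟨fun l i => if i ≤ l ∧ ‖D (e l.unpair.1 i)‖ ≤ 2 ^ l then D (e l.unpair.1 i) else 0,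
    fun l i hli => if_neg (by omega), fun l i => ?_, fun y ε n L hε => ?_⟩
  · dsimp only
    split_ifs with h
    · exact h.2
    · simp
  · have hD : ∀ i, ∃ k, ‖D (k + 1) - y i‖ < ε i := fun i => by
      obtain ⟨k, hk⟩ := (TopologicalSpace.denseRange_denseSeq 𝕜).exists_dist_lt (y i) (hε i)
      exact ⟨k, by rwa [dist_comm, dist_eq_norm] at hk⟩
    choose K hK using hD
    let φ : ℕ →₀ ℕ := Finsupp.onFinset (Finset.range n) (fun i => if i < n then K i + 1 else 0)
      (by intro i; simp)
    have hφ : ∀ i, φ i = if i < n then K i + 1 else 0 := fun i => rfl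
    obtain ⟨m, hm⟩ := he φ
    obtain ⟨B, hB⟩ := exists_nat_ge (∑ i ∈ Finset.range n, ‖D (φ i)‖)
    refine ⟨Nat.pair m (L + n + B), ?_, fun i hi => ?_, fun i hi => ?_⟩
    · exact le_trans (by omega) (Nat.right_le_pair m (L + n + B))
    · have hle := Nat.right_le_pair m (L + n + B)
      dsimp only
      rw [Nat.unpair_pair, hm, if_pos, hφ, if_pos hi]
      · exact hK i
      · refine ⟨by omega, ?_⟩
        calc ‖D (φ i)‖ ≤ ∑ i ∈ Finset.range n, ‖D (φ i)‖ :=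
              Finset.single_le_sum (f := fun i => ‖D (φ i)‖) (fun i _ => norm_nonneg _)
                (Finset.mem_range.2 hi)
          _ ≤ B := hB
          _ ≤ ((2 ^ Nat.pair m (L + n + B) : ℕ) : ℝ) := by
              exact_mod_cast (by omega : B ≤ Nat.pair m (L + n + B)).trans
                (Nat.lt_pow_self (by norm_num)).le
          _ = _ := by push_cast; rfl
    · dsimp only
      rw [Nat.unpair_pair, hm, hφ, if_neg (not_lt.2 hi)]
      simp [D]

section FrequentHypercyclicity

variable {𝕜 : Type*} [RCLike 𝕜] {α : ℕ → ℝ}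

/-- An entry of size at most `2 ^ l'` is negligible where no jump occurred for `l + l'` steps. -/
theorem norm_div_weightProd_mul_le (hα1 : ∀ n, 1 ≤ α n)
    (hconst : ∀ n, n + 1 ∉ Set.range jumpTime → α (n + 1) = α n) {l l' k p : ℕ}
    (h : NoJump (l + l') k) (hp : p ≤ 2 ^ l) {y : 𝕜} (hy : ‖y‖ ≤ 2 ^ l') :
    ‖y‖ / weightProd (fun n => (2 : ℝ) ^ α n) k * (p : ℝ) ^ α k ≤ p / 2 ^ l := by
  have h1 := h.rpow_div_weightProd_le hα1 hconst
    (hp.trans (Nat.pow_le_pow_right (by norm_num) (Nat.le_add_right l l')))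
  calc ‖y‖ / weightProd (fun n => (2 : ℝ) ^ α n) k * (p : ℝ) ^ α k
      = ‖y‖ * ((p : ℝ) ^ α k / weightProd (fun n => (2 : ℝ) ^ α n) k) := by ring
    _ ≤ 2 ^ l' * (p / 2 ^ (l + l')) := by
        refine mul_le_mul hy h1 (div_nonneg (by positivity) ?_) (by positivity)
        exact (weightProd_pos (fun n => by positivity) k).le
    _ = p / 2 ^ l := by
        rw [pow_add]
        field_simp

theorem tendsto_blockSeq_div (hα1 : ∀ n, 1 ≤ α n)
    (hconst : ∀ n, n + 1 ∉ Set.range jumpTime → α (n + 1) = α n) {f : ℕ → ℕ → 𝕜}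
    (hf : ∀ l i, l < i → f l i = 0) (hf2 : ∀ l i, ‖f l i‖ ≤ 2 ^ l) (p : ℕ) :
    Tendsto (fun k => ‖blockSeq f k‖ / weightProd (fun n => (2 : ℝ) ^ α n) k * (p : ℝ) ^ α k)
      atTop (𝓝 0) := by
  have hlog : Tendsto (Nat.log 16) atTop atTop :=
    tendsto_atTop_atTop_of_monotone Nat.log_monotone fun b =>
      ⟨16 ^ b, (Nat.log_pow (by norm_num) b).ge⟩
  have hlim : Tendsto (fun k => (p : ℝ) / 2 ^ Nat.log 16 k) atTop (𝓝 0) :=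
    (tendsto_const_nhds.div_atTop (tendsto_pow_atTop_atTop_of_one_lt one_lt_two)).comp hlog
  refine squeeze_zero' (Eventually.of_forall fun k => ?_) ?_ hlim
  · have := weightProd_pos (w := fun n => (2 : ℝ) ^ α n) (fun n => by positivity) k
    positivity
  filter_upwards [eventually_ne_atTop 0, hlog.eventually_ge_atTop p] with k hk hkp
  by_cases hy : blockSeq f k = 0
  · rw [hy]
    simp only [norm_zero, zero_div, zero_mul]
    positivity
  obtain ⟨u, j, i, hi, hr, rfl, hval⟩ := exists_of_blockSeq_ne_zero hf hk hy
  rw [log_eq_of_block hr] at hkp ⊢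
  -- Block u allows 2u jump-free steps: blockLabel u ≤ u of them absorb the size of the entry, and u
  -- remain for the decay p/2^u.
  refine norm_div_weightProd_mul_le hα1 hconst (l' := blockLabel u)
    ((noJump_of_block (u := u) (by omega) (by omega)).mono ?_)
    (hkp.trans (Nat.lt_pow_self (by norm_num)).le) (hval ▸ hf2 _ _)
  have := blockLabel_le u
  omega

theorem isFrequentlyHypercyclic_expShift (hα : ∀ n, 0 < α n) (hmono : Monotone α)
    (hα1 : ∀ n, 1 ≤ α n) (hconst : ∀ n, n + 1 ∉ Set.range jumpTime → α (n + 1) = α n) :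
    IsFrequentlyHypercyclic (expShift 𝕜 hα hmono) := by
  obtain ⟨f, hf, hf2, hdense⟩ := exists_dense_targets 𝕜
  set v := weightProd fun n => (2 : ℝ) ^ α n with hv
  have hvpos : ∀ n, 0 < v n := weightProd_pos fun n => by positivity
  have hnorm : ∀ (y : 𝕜) n, ‖y / (v n : 𝕜)‖ = ‖y‖ / v n := fun y n => by
    rw [norm_div, RCLike.norm_of_nonneg (hvpos n).le]
  have hv0 : ∀ n, (v n : 𝕜) ≠ 0 := fun n => RCLike.ofReal_ne_zero.2 (hvpos n).ne'
  let x : PowerSeriesC0 𝕜 α hα := KotheC0.ofSeq (fun k => blockSeq f k / (v k : 𝕜)) fun m => by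
    simp only [hnorm]
    exact tendsto_blockSeq_div hα1 hconst hf hf2 m
  have hTx : ∀ n k, ((expShift 𝕜 hα hmono)^[n] x).coord k = blockSeq f (n + k) / (v k : 𝕜) := by
    intro n k
    have h := (isWeightedShift_expShift 𝕜 hα hmono).coord_iterate x n k
    rw [KotheC0.coord_ofSeq, mul_div_cancel₀ _ (hv0 _), add_comm k n] at h
    rw [eq_div_iff (hv0 k), mul_comm, h]
  refine ⟨x, fun U hU hUne => ?_⟩
  obtain ⟨z, hz⟩ := hUne
  obtain ⟨m, r, hr, hball⟩ := KotheC0.exists_seminorm_ball_subset hU hz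
  set A := powerSeriesMatrix α hα
  obtain ⟨n₀, hn₀⟩ := eventually_atTop.1 ((z.tendsto_coord m).eventually_lt_const
    (show 0 < r / 3 by positivity))
  -- With 2^l ≥ L, this gives both m ≤ 2^l and m/2^l ≤ r/3.
  obtain ⟨L, hL⟩ := exists_nat_ge (3 * (m : ℕ) / r + (m : ℕ))
  -- The tolerance becomes r/3 after division by v_i and multiplication by a_{m,i}.
  obtain ⟨l, hlL, hclose, hzero⟩ := hdense (fun i => (v i : 𝕜) * z.coord i)
    (fun i => r / 3 * v i / A.a m i) n₀ L
    (fun i => div_pos (mul_pos (by positivity) (hvpos i)) (A.pos m i))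
  have hl2 : (L : ℝ) ≤ 2 ^ l := by exact_mod_cast hlL.trans (Nat.lt_pow_self (by norm_num)).le
  have hml : (m : ℕ) ≤ 2 ^ l := by
    have : ((m : ℕ) : ℝ) ≤ 2 ^ l :=
      le_trans (by linarith [show 0 ≤ 3 * ((m : ℕ) : ℝ) / r by positivity]) hl2
    exact_mod_cast this
  have hmr : ((m : ℕ) : ℝ) / 2 ^ l ≤ r / 3 := by
    have : 3 * ((m : ℕ) : ℝ) / r ≤ 2 ^ l :=
      le_trans (by linarith [show 0 ≤ ((m : ℕ) : ℝ) by positivity]) hl2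
    rw [div_le_iff₀ hr] at this
    rw [div_le_iff₀ (by positivity)]
    linarith
  refine lowerDensity_pos_of_visitTimes_subset (l := l) fun n hn => hball _ ?_
  -- One third is for the later entries of the block sequence and one for approximating z; the last
  -- gives strictness for the supremum.
  refine lt_of_le_of_lt (KotheC0.seminorm_le (C := r / 3 + r / 3) fun d => ?_) (by linarith)
  have htarget : ‖f l d / (v d : 𝕜) - z.coord d‖ * A.a m d ≤ r / 3 := by
    rcases lt_or_ge d n₀ with hd | hd
    · have h := (hclose d hd).le
      have e : f l d / (v d : 𝕜) - z.coord d = (f l d - (v d : 𝕜) * z.coord d) / (v d : 𝕜) := by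
        rw [sub_div, mul_div_cancel_left₀ _ (hv0 d)]
      rw [le_div_iff₀ (A.pos m d)] at h
      rw [e, hnorm, div_mul_eq_mul_div, div_le_iff₀ (hvpos d)]
      exact h
    · simpa [hzero d hd] using (hn₀ d hd).le
  have herror : ‖(blockSeq f (n + d) - f l d) / (v d : 𝕜)‖ * A.a m d ≤ r / 3 := by
    rcases le_or_gt d l with hd | hd
    · obtain ⟨u, j, rfl, hj, rfl⟩ := hn
      rw [blockSeq_visit hj hd, sub_self, zero_div, norm_zero, zero_mul]
      positivity
    · rw [hf l d hd, sub_zero]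
      by_cases hy : blockSeq f (n + d) = 0
      · rw [hy, zero_div, norm_zero, zero_mul]
        positivity
      · obtain ⟨l', i, hval, hno⟩ := exists_noJump_of_blockSeq_ne_zero hf hn hd hy
        rw [hnorm]
        exact (norm_div_weightProd_mul_le hα1 hconst hno hml (hval ▸ hf2 l' i)).trans hmr
  rw [KotheC0.coord_sub, hTx]
  calc ‖blockSeq f (n + d) / (v d : 𝕜) - z.coord d‖ * A.a m d
      = ‖(blockSeq f (n + d) - f l d) / (v d : 𝕜) + (f l d / (v d : 𝕜) - z.coord d)‖ * A.a m d := by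
        congr 2
        ring
    _ ≤ _ := by
        refine (mul_le_mul_of_nonneg_right (norm_add_le _ _) (A.pos m d).le).trans ?_
        rw [add_mul]
        exact add_le_add herror htarget

end FrequentHypercyclicity

end

theorem theorem1p2 (𝕜 : Type*) [RCLike 𝕜] :
    ∃ (N : ℕ → ℕ) (α : ℕ → ℝ) (hα : ∀ n, 0 < α n),
      -- the sparse sequence `N_0 < N_1 < ...`
      StrictMono N ∧ N 0 = 0 ∧ Tendsto (fun k => N (k + 1) - N k) atTop atTop ∧
      -- the exponents are constant, except that they jump to the partial sums along `N`
      α 0 = 1 ∧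
      (∀ k, 1 ≤ k → α (N k) = ∑ i ∈ Finset.range (N k), α i) ∧
      (∀ n, n + 1 ∉ Set.range N → α (n + 1) = α n) ∧
      -- they are admissible for a power series space of infinite type
      Monotone α ∧ Tendsto α atTop atTop ∧
      -- the Köthe space supports a frequently hypercyclic weighted shift
      (∃ (w : ℕ → ℝ) (T : PowerSeriesC0 𝕜 α hα →L[𝕜] PowerSeriesC0 𝕜 α hα),
        IsWeightedShift w T ∧ IsFrequentlyHypercyclic T) ∧
      -- but no chaotic weighted shift
      (∀ (w : ℕ → ℝ) (T : PowerSeriesC0 𝕜 α hα →L[𝕜] PowerSeriesC0 𝕜 α hα),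
        IsWeightedShift w T → ¬ IsChaotic T) := by
  have hα : ∀ n, 0 < exponent n := fun n => zero_lt_one.trans_le (one_le_exponent n)
  refine ⟨jumpTime, exponent, hα, strictMono_jumpTime, rfl, tendsto_jumpTime_sub, rfl,
    fun k hk => exponent_jumpTime hk, fun n hn => exponent_succ_of_notMem hn, monotone_exponent,
    tendsto_exponent, ⟨_, _, isWeightedShift_expShift 𝕜 hα monotone_exponent,
      isFrequentlyHypercyclic_expShift hα monotone_exponent one_le_exponent
        fun n hn => exponent_succ_of_notMem hn⟩, fun w T hT => ?_⟩
  exact not_isChaotic_of_isWeightedShift strictMono_jumpTime tendsto_jumpTime_sub one_le_exponent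
    (fun k hk => exponent_jumpTime hk) (fun n hn => exponent_succ_of_notMem hn) hT
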